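/- All matrices are real. A symmetric matrix $A$ is copositive if $x^TAx\ge 0$ for every entrywise nonnegative vector $x$, and it is SPN if $A=P+N$ with $P$ symmetric positive semidefinite and $N$ symmetric and entrywise nonnegative. The graph $G(A)$ of a symmetric $n\times n$ matrix $A$ is the simple graph with vertices $1,\dots,n$ in which distinct vertices $i$ and $j$ are adjacent if and only if $a_{ij}\ne 0$. A finite simple graph $G$ is called SPN if every copositive matrix $A$ with $G(A)=G$ is SPN. For $n\ge 4$ let $DR_n$ denote the graph on $n$ vertices obtained from the complete graph $K_4$ by replacing one of its edges by a path of length $n-3$ with the same two ends, whose $n-4$ inner vertices are new and have no neighbours outside the path. Theorem. For every $n\ge 5$, the graph $DR_n$ (with its vertices labelled in any way) is SPN. -/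

import Mathlib

open Matrix

/-- A real symmetric matrix `A` is copositive if `xᵀ A x ≥ 0` for every entrywise nonnegative
vector `x`. -/
def IsCopositive {V : Type*} [Fintype V] (A : Matrix V V ℝ) : Prop :=
  A.IsSymm ∧ ∀ x : V → ℝ, (∀ i, 0 ≤ x i) → 0 ≤ x ⬝ᵥ (A *ᵥ x)

/-- A matrix is SPN if it is the sum of a real (symmetric) positive semidefinite matrix and a
symmetric entrywise nonnegative matrix. -/
def IsSPN {V : Type*} [Fintype V] (A : Matrix V V ℝ) : Prop :=
  ∃ P N : Matrix V V ℝ, P.PosSemidef ∧ N.IsSymm ∧ (∀ i j, 0 ≤ N i j) ∧ A = P + N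

/-- The graph of a symmetric matrix `A`: distinct `i` and `j` are adjacent iff `A i j ≠ 0`.
(`SimpleGraph.fromRel` removes loops and symmetrizes, which has no effect off the diagonal when
`A` is symmetric.) -/
def matrixGraph {V : Type*} (A : Matrix V V ℝ) : SimpleGraph V :=
  SimpleGraph.fromRel fun i j => A i j ≠ 0

/-- A finite simple graph `G` is SPN if every copositive matrix whose graph is `G` is SPN. -/
def IsSPNGraph {V : Type*} [Fintype V] (G : SimpleGraph V) : Prop :=
  ∀ A : Matrix V V ℝ, IsCopositive A → matrixGraph A = G → IsSPN A

/-- For `n ≥ 4`, the graph `DR_n` on the vertices `0, …, n - 1`, obtained from the complete graph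
`K_4` on `{0, n - 3, n - 2, n - 1}` by replacing the edge between `0` and `n - 3` by the
independent path `0 - 1 - ⋯ - (n - 3)` of length `n - 3`. Its edges are the edges of this path,
the four edges joining an end of the path to `n - 2` or `n - 1`, and the edge between `n - 2` and
`n - 1`. -/
def graphDR (n : ℕ) : SimpleGraph (Fin n) :=
  SimpleGraph.fromRel fun i j =>
    (i.val + 1 = j.val ∧ j.val + 3 ≤ n) ∨
    ((i.val = 0 ∨ i.val + 3 = n) ∧ (j.val + 2 = n ∨ j.val + 1 = n)) ∨
    (i.val + 2 = n ∧ j.val + 1 = n)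

open Filter Topology

/-! The proof is an induction on the length of the path, eliminating an inner vertex `i` of degree
two. Only containment of the support in the graph is assumed, so entries may vanish along the way.

If row `i` is nonpositive off the diagonal, the Schur complement at `i` is still copositive. It
differs from `A` by a positive semidefinite matrix, and its only fill-in joins the two neighbours of
`i`, so it lives on the graph with a shorter path. The induction ends at order four, where the same
dichotomy works.

If some `A i j` is positive, subtract the largest multiple of `x i * x j`, up to the entry itself,
that preserves copositivity. Either the entry is killed, or `exists_zero_of_pair` yields a
nonnegative zero `u` of the form whose gradient vanishes at `i` and `j`, with `u i + u j > 0`.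
Cutting the graph at the edge `i j` (`false_of_bridge`) shows that `u` is positive on the rest of
the path and at `a` or `b`. Such a large support makes the form positive semidefinite on a
coordinate hyperplane (`isSPN_of_zero`), and this already forces a copositive matrix to be SPN
(`isSPN_of_forall_apply_eq_zero`). -/

theorem single_one_nonneg {V : Type*} [DecidableEq V] (i j : V) :
    0 ≤ (Pi.single i 1 : V → ℝ) j := by
  rw [Pi.single_apply]
  split_ifs <;> simp

theorem Matrix.PosSemidef.isSymm {V : Type*} {A : Matrix V V ℝ}
    (hA : A.PosSemidef) : A.IsSymm := by
  have h := hA.isHermitian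
  rwa [IsHermitian, conjTranspose_eq_transpose_of_trivial] at h

/-! ### Quadratic forms of symmetric matrices -/

section Quadratic

variable {V : Type*} [Fintype V] {A : Matrix V V ℝ}

theorem Matrix.IsSymm.dotProduct_mulVec_comm (hA : A.IsSymm) (x y : V → ℝ) :
    x ⬝ᵥ A *ᵥ y = y ⬝ᵥ A *ᵥ x := by
  rw [dotProduct_mulVec, ← mulVec_transpose, hA.eq, dotProduct_comm]

theorem Matrix.IsSymm.dotProduct_mulVec_add_smul (hA : A.IsSymm) (x y : V → ℝ) (t : ℝ) :
    (x + t • y) ⬝ᵥ A *ᵥ (x + t • y) =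
      x ⬝ᵥ A *ᵥ x + 2 * t * (x ⬝ᵥ A *ᵥ y) + t ^ 2 * (y ⬝ᵥ A *ᵥ y) := by
  simp only [mulVec_add, mulVec_smul, add_dotProduct, dotProduct_add, smul_dotProduct,
    dotProduct_smul, smul_eq_mul, hA.dotProduct_mulVec_comm y x]
  ring

theorem Matrix.IsSymm.dotProduct_mulVec_add (hA : A.IsSymm) (x y : V → ℝ) :
    (x + y) ⬝ᵥ A *ᵥ (x + y) = x ⬝ᵥ A *ᵥ x + 2 * (x ⬝ᵥ A *ᵥ y) + y ⬝ᵥ A *ᵥ y := by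
  simpa using hA.dotProduct_mulVec_add_smul x y 1

theorem continuous_dotProduct_mulVec (A : Matrix V V ℝ) :
    Continuous fun x : V → ℝ => x ⬝ᵥ A *ᵥ x := by
  fun_prop

theorem posSemidef_of_isSymm (hA : A.IsSymm) (h : ∀ x : V → ℝ, 0 ≤ x ⬝ᵥ A *ᵥ x) :
    A.PosSemidef :=
  .of_dotProduct_mulVec_nonneg (by rwa [IsHermitian, conjTranspose_eq_transpose_of_trivial])
    (by simpa using h)

theorem Matrix.PosSemidef.dotProduct_mulVec_self_nonneg (hA : A.PosSemidef) (x : V → ℝ) :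
    0 ≤ x ⬝ᵥ A *ᵥ x := by
  simpa using hA.dotProduct_mulVec_nonneg x

/-- An off-diagonal entry of a positive semidefinite matrix is bounded by the diagonal. -/
theorem Matrix.PosSemidef.abs_apply_le (hA : A.PosSemidef) (i j : V) :
    |A i j| ≤ A i i + A j j := by
  classical
  have e : ∀ k l : V, Pi.single k (1 : ℝ) ⬝ᵥ A *ᵥ Pi.single l 1 = A k l := fun k l => by simp
  have h1 := hA.dotProduct_mulVec_self_nonneg (Pi.single i 1 + (1 : ℝ) • Pi.single j 1)
  have h2 := hA.dotProduct_mulVec_self_nonneg (Pi.single i 1 + (-1 : ℝ) • Pi.single j 1)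
  rw [hA.isSymm.dotProduct_mulVec_add_smul, e, e, e] at h1 h2
  have h3 := hA.diag_nonneg (i := i)
  have h4 := hA.diag_nonneg (i := j)
  rw [abs_le]
  constructor <;> linarith

end Quadratic

/-! ### The cone of SPN matrices and its closedness -/

section SPN

variable {V : Type*} [Fintype V] {A N : Matrix V V ℝ}

theorem IsSPN.add_nonneg (hA : IsSPN A) (hN : N.IsSymm) (h : ∀ i j, 0 ≤ N i j) :
    IsSPN (A + N) := by
  obtain ⟨P, M, hP, hM, hM0, rfl⟩ := hA
  exact ⟨P, M + N, hP, hM.add hN, fun i j => _root_.add_nonneg (hM0 i j) (h i j),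
    add_assoc _ _ _⟩

theorem Matrix.PosSemidef.add_isSPN {P : Matrix V V ℝ} (hP : P.PosSemidef) (hA : IsSPN A) :
    IsSPN (P + A) := by
  obtain ⟨Q, M, hQ, hM, hM0, rfl⟩ := hA
  exact ⟨P + Q, M, hP.add hQ, hM, hM0, (add_assoc _ _ _).symm⟩

theorem Matrix.PosSemidef.isSPN (hA : A.PosSemidef) : IsSPN A :=
  ⟨A, 0, hA, isSymm_zero, by simp, by simp⟩

/-- The cone of SPN matrices is closed along the perturbations `A + η I`, `η → 0`. -/
theorem isSPN_of_forall_add_smul_one [DecidableEq V] (hA : A.IsSymm)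
    (h : ∀ η : ℝ, 0 < η → IsSPN (A + η • (1 : Matrix V V ℝ))) : IsSPN A := by
  let η : ℕ → ℝ := fun k => 1 / ((k : ℝ) + 1)
  have hη : ∀ k, 0 < η k := fun k => by positivity
  have hη1 : ∀ k, η k ≤ 1 := fun k => by
    have : (0 : ℝ) ≤ k := k.cast_nonneg
    exact (div_le_one (by positivity)).2 (by linarith)
  have hη0 : Tendsto η atTop (𝓝 0) := tendsto_one_div_add_atTop_nhds_zero_nat
  choose P N hP hN hN0 e using fun k => h (η k) (hη k)
  have e' : ∀ k i j, P k i j + N k i j = A i j + η k * (1 : Matrix V V ℝ) i j := fun k i j => by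
    have := congrFun (congrFun (e k) i) j
    simpa using this.symm
  -- Since `N k` is nonnegative and `η k ≤ 1`, the diagonal of `P k` is at most that of `A` plus
  -- one, which bounds every entry of `P k`.
  let K : Set (V → V → ℝ) := Set.univ.pi fun i => Set.univ.pi fun j =>
    Set.Icc (-(A i i + A j j + 2)) (A i i + A j j + 2)
  have hK : IsCompact K := isCompact_univ_pi fun i => isCompact_univ_pi fun j => isCompact_Icc
  have hPK : ∀ k, (fun i j => P k i j) ∈ K := fun k => by
    simp only [K, Set.mem_univ_pi, Set.mem_Icc, ← abs_le]
    intro i j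
    have d : ∀ l, P k l l ≤ A l l + 1 := fun l => by
      have h1 := e' k l l
      rw [one_apply_eq, mul_one] at h1
      linarith [hN0 k l l, hη1 k]
    linarith [(hP k).abs_apply_le i j, d i, d j]
  obtain ⟨Q, -, φ, hφ, hQ⟩ := hK.tendsto_subseq hPK
  have hQ' : ∀ i j, Tendsto (fun k => P (φ k) i j) atTop (𝓝 (Q i j)) := fun i j =>
    tendsto_pi_nhds.1 (tendsto_pi_nhds.1 hQ i) j
  have hQs : (of Q).IsSymm := IsSymm.ext fun i j =>
    tendsto_nhds_unique (hQ' j i) ((hQ' i j).congr fun k => (hP (φ k)).isSymm.apply j i)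
  refine ⟨of Q, A - of Q, posSemidef_of_isSymm hQs fun x => ?_, hA.sub hQs, fun i j => ?_,
    by simp⟩
  · have hc : Continuous fun M : V → V → ℝ => x ⬝ᵥ (of M) *ᵥ x := by
      simp only [dotProduct, mulVec, of_apply]
      fun_prop
    exact ge_of_tendsto' ((hc.tendsto Q).comp hQ) fun k =>
      (hP (φ k)).dotProduct_mulVec_self_nonneg x
  · have h1 : Tendsto (fun k => A i j + η (φ k) * (1 : Matrix V V ℝ) i j - P (φ k) i j) atTop
        (𝓝 (A i j + 0 * (1 : Matrix V V ℝ) i j - Q i j)) :=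
      (tendsto_const_nhds.add ((hη0.comp hφ.tendsto_atTop).mul_const _)).sub (hQ' i j)
    have h2 := ge_of_tendsto' h1 (b := 0) fun k => by
      rw [← e' (φ k) i j]
      simpa using hN0 (φ k) i j
    simpa using h2

end SPN

/-! ### Zeros of copositive forms and sufficient conditions for SPN -/

section Copositive

variable {V : Type*} [Fintype V] {A : Matrix V V ℝ}

theorem IsCopositive.diag_nonneg (hA : IsCopositive A) (i : V) : 0 ≤ A i i := by
  classical
  simpa using hA.2 (Pi.single i 1) (single_one_nonneg i)

/-- The gradient of a copositive form at a nonnegative zero is nonnegative. -/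
theorem IsCopositive.mulVec_nonneg_of_zero (hA : IsCopositive A) {u : V → ℝ}
    (hu : ∀ i, 0 ≤ u i) (hq : u ⬝ᵥ A *ᵥ u = 0) (i : V) : 0 ≤ (A *ᵥ u) i := by
  classical
  by_contra! hlt
  set g := (A *ᵥ u) i with hg
  have hd := hA.diag_nonneg i
  -- A step of this size along the `i`-th axis changes the form by `2 * t * g + t ^ 2 * A i i = t *
  -- g - t ^ 2 < 0`; the `+ 1` covers a zero diagonal entry.
  set t := -g / (A i i + 1)
  have ht : 0 < t := div_pos (by linarith) (by linarith)
  have ht' : t * (A i i + 1) = -g := div_mul_cancel₀ _ (by linarith)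
  have h := hA.2 (u + t • Pi.single i 1) fun j => by
    have : (0 : ℝ) ≤ (Pi.single i 1 : V → ℝ) j := single_one_nonneg i j
    simpa using add_nonneg (hu j) (mul_nonneg ht.le this)
  rw [hA.1.dotProduct_mulVec_add_smul, hq, hA.1.dotProduct_mulVec_comm u, single_one_dotProduct,
    single_one_dotProduct, ← hg] at h
  have h2 : (A *ᵥ Pi.single i 1) i = A i i := by simp
  rw [h2] at h
  nlinarith

/-- Complementarity: the terms `u j * (A *ᵥ u) j` are nonnegative and sum to zero. -/
theorem IsCopositive.mulVec_eq_zero_of_pos (hA : IsCopositive A) {u : V → ℝ}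
    (hu : ∀ i, 0 ≤ u i) (hq : u ⬝ᵥ A *ᵥ u = 0) {i : V} (hi : 0 < u i) : (A *ᵥ u) i = 0 := by
  have h := (Finset.sum_eq_zero_iff_of_nonneg fun j _ =>
    mul_nonneg (hu j) (hA.mulVec_nonneg_of_zero hu hq j)).1 hq i (Finset.mem_univ i)
  exact (mul_eq_zero.1 h).resolve_left hi.ne'

/-- A coercive copositive form attains its minimum over the nonnegative vectors with a given
coordinate equal to one. -/
theorem exists_min_of_coercive {η : ℝ} (hη : 0 < η)
    (h : ∀ x : V → ℝ, (∀ i, 0 ≤ x i) → η * (x ⬝ᵥ x) ≤ x ⬝ᵥ A *ᵥ x) (b : V) :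
    ∃ y : V → ℝ, (∀ i, 0 ≤ y i) ∧ y b = 1 ∧
      ∀ x : V → ℝ, (∀ i, 0 ≤ x i) → x b = 1 → y ⬝ᵥ A *ᵥ y ≤ x ⬝ᵥ A *ᵥ x := by
  classical
  set e : V → ℝ := Pi.single b 1 with he
  have he0 : ∀ i, 0 ≤ e i := single_one_nonneg b
  have heb : e b = 1 := by simp [e]
  set c := e ⬝ᵥ A *ᵥ e with hc
  have hc0 : 0 ≤ c := (by simpa [e] using hη.le : (0 : ℝ) ≤ η * (e ⬝ᵥ e)).trans (h e he0)
  set R := c / η + 1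
  have hR : 1 ≤ R := by have := div_nonneg hc0 hη.le; linarith
  have hRc : c < η * R := by
    have : η * R = c + η := by simp only [R]; field_simp
    linarith
  let K : Set (V → ℝ) := Set.Icc 0 (fun _ => R) ∩ {x | x b = 1}
  have hK : IsCompact K := isCompact_Icc.inter_right
    (isClosed_eq (continuous_apply b) continuous_const)
  have heK : e ∈ K := ⟨⟨he0, fun j => by
    by_cases h : j = b
    · subst h; simpa [e] using hR
    · simpa [e, h] using by linarith⟩, heb⟩
  obtain ⟨y, hyK, hy⟩ := hK.exists_isMinOn ⟨e, heK⟩ (continuous_dotProduct_mulVec A).continuousOn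
  refine ⟨y, hyK.1.1, hyK.2, fun x hx hxb => ?_⟩
  by_cases hxR : ∀ i, x i ≤ R
  · exact hy ⟨⟨hx, hxR⟩, hxb⟩
  · push Not at hxR
    obtain ⟨i, hi⟩ := hxR
    have h1 : x i * x i ≤ x ⬝ᵥ x :=
      Finset.single_le_sum (f := fun j => x j * x j) (fun j _ => mul_self_nonneg _)
        (Finset.mem_univ i)
    have h2 : R ≤ x ⬝ᵥ x := by nlinarith
    calc y ⬝ᵥ A *ᵥ y ≤ c := hy heK
      _ ≤ η * R := hRc.le
      _ ≤ η * (x ⬝ᵥ x) := mul_le_mul_of_nonneg_left h2 hη.le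
      _ ≤ _ := h x hx

/-- The first-order conditions at the minimizer `y` make `g = A *ᵥ y` nonnegative off `b` and
complementary to `y` there. Place `g`, with its entry at `b` erased, in row and column `b` to form
`N`. Writing `x = z + x b • y` with `z b = 0`, the cross term of `A` is exactly the form of `N`, so
`A - N` takes the value `z ⬝ᵥ A *ᵥ z + x b ^ 2 * (y ⬝ᵥ A *ᵥ y)`. -/
theorem isSPN_of_min (hA : A.IsSymm) (b : V) (hb : ∀ z : V → ℝ, z b = 0 → 0 ≤ z ⬝ᵥ A *ᵥ z)
    {y : V → ℝ} (hy0 : ∀ i, 0 ≤ y i) (hyb : y b = 1) (hq : 0 ≤ y ⬝ᵥ A *ᵥ y)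
    (hy : ∀ x : V → ℝ, (∀ i, 0 ≤ x i) → x b = 1 → y ⬝ᵥ A *ᵥ y ≤ x ⬝ᵥ A *ᵥ x) : IsSPN A := by
  classical
  set g := A *ᵥ y with hg
  have hmin : ∀ l, l ≠ b → ∀ t : ℝ, 0 ≤ y l + t → 0 ≤ 2 * t * g l + t ^ 2 * A l l := by
    intro l hl t ht
    have h1 := hy (y + t • Pi.single l 1) (fun i => by
      by_cases h : i = l
      · subst h; simpa using ht
      · simpa [h] using hy0 i) (by simp [hl.symm, hyb])
    rw [hA.dotProduct_mulVec_add_smul, hA.dotProduct_mulVec_comm y (Pi.single l 1),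
      single_one_dotProduct, single_one_dotProduct, ← hg] at h1
    have h2 : (A *ᵥ Pi.single l 1) l = A l l := by simp
    rw [h2] at h1
    linarith
  have hd : ∀ l, l ≠ b → 0 ≤ A l l := fun l hl => by
    have := hb (Pi.single l 1) (by simp [hl.symm])
    simpa using this
  have hg0 : ∀ l, l ≠ b → 0 ≤ g l := by
    intro l hl
    by_contra! hlt
    have hdl := hd l hl
    have ht : 0 < -g l / (A l l + 1) := div_pos (by linarith) (by linarith)
    have ht' : -g l / (A l l + 1) * (A l l + 1) = -g l := div_mul_cancel₀ _ (by linarith)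
    have h := hmin l hl (-g l / (A l l + 1)) (add_nonneg (hy0 l) ht.le)
    nlinarith
  have hgy : ∀ l, l ≠ b → g l * y l = 0 := by
    intro l hl
    rcases (hy0 l).eq_or_lt with h0 | hpos
    · rw [← h0, mul_zero]
    rcases (hg0 l hl).eq_or_lt with h0 | hgpos
    · rw [← h0, zero_mul]
    exfalso
    have hdl := hd l hl
    set t := min (y l) (g l / (A l l + 1)) with ht
    have ht0 : 0 < t := lt_min hpos (div_pos hgpos (by linarith))
    have ht1 : t * (A l l + 1) ≤ g l := by
      rw [← le_div_iff₀ (by linarith)]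
      exact min_le_right _ _
    have h := hmin l hl (-t) (by linarith [min_le_left (y l) (g l / (A l l + 1))])
    nlinarith
  let g' : V → ℝ := Function.update g b 0
  have hg'b : g' b = 0 := by simp [g']
  have hg' : ∀ l, l ≠ b → g' l = g l := fun l hl => by simp [g', hl]
  have hg'0 : ∀ l, 0 ≤ g' l := fun l => by
    by_cases h : l = b
    · rw [h, hg'b]
    · rw [hg' l h]; exact hg0 l h
  let N : Matrix V V ℝ := vecMulVec (Pi.single b 1) g' + vecMulVec g' (Pi.single b 1)
  have hNs : N.IsSymm := by
    ext i j
    simp only [N, transpose_apply, Matrix.add_apply, vecMulVec_apply]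
    ring
  have hN0 : ∀ i j, 0 ≤ N i j := fun i j => by
    have hs : ∀ k, 0 ≤ (Pi.single b 1 : V → ℝ) k := single_one_nonneg b
    exact add_nonneg (mul_nonneg (hs i) (hg'0 j)) (mul_nonneg (hg'0 i) (hs j))
  refine ⟨A - N, N, posSemidef_of_isSymm (hA.sub hNs) fun x => ?_, hNs, hN0, by simp⟩
  have hNx : x ⬝ᵥ N *ᵥ x = 2 * x b * (g' ⬝ᵥ x) := by
    simp only [N, add_mulVec, vecMulVec_mulVec, dotProduct_add, dotProduct_smul,
      single_one_dotProduct, dotProduct_single_one, MulOpposite.smul_eq_mul_unop,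
      MulOpposite.unop_op, dotProduct_comm x g']
    ring
  have hz : (x - x b • y) b = 0 := by simp [hyb]
  have hx : x = (x - x b • y) + x b • y := by simp
  have hAx := hA.dotProduct_mulVec_add_smul (x - x b • y) y (x b)
  rw [← hx, ← hg] at hAx
  have h1 : (x - x b • y) ⬝ᵥ g = (x - x b • y) ⬝ᵥ g' := Finset.sum_congr rfl fun l _ => by
    by_cases h : l = b
    · rw [h, hz, zero_mul, zero_mul]
    · rw [hg' l h]
  have h2 : g' ⬝ᵥ y = 0 := Finset.sum_eq_zero fun l _ => by
    by_cases h : l = b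
    · rw [h, hg'b, zero_mul]
    · rw [hg' l h, hgy l h]
  have h3 : (x - x b • y) ⬝ᵥ g' = g' ⬝ᵥ x := by
    rw [sub_dotProduct, smul_dotProduct, dotProduct_comm y, h2, smul_zero, sub_zero,
      dotProduct_comm]
  rw [sub_mulVec, dotProduct_sub, hAx, hNx, h1, h3]
  have h4 := hb _ hz
  have h5 := mul_nonneg (sq_nonneg (x b)) hq
  linarith

/-- A copositive matrix that is positive semidefinite on a coordinate hyperplane is SPN. -/
theorem IsCopositive.isSPN_of_forall_apply_eq_zero (hA : IsCopositive A) (b : V)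
    (hb : ∀ z : V → ℝ, z b = 0 → 0 ≤ z ⬝ᵥ A *ᵥ z) : IsSPN A := by
  classical
  -- The perturbation makes the form coercive, so that its minimum over `x b = 1` is attained.
  refine isSPN_of_forall_add_smul_one hA.1 fun η hη => ?_
  have hq : ∀ x : V → ℝ, x ⬝ᵥ (A + η • (1 : Matrix V V ℝ)) *ᵥ x =
      x ⬝ᵥ A *ᵥ x + η * (x ⬝ᵥ x) := fun x => by
    simp [add_mulVec, smul_mulVec, dotProduct_add]
  have hxx : ∀ x : V → ℝ, 0 ≤ η * (x ⬝ᵥ x) := fun x =>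
    mul_nonneg hη.le (Finset.sum_nonneg fun i _ => mul_self_nonneg _)
  obtain ⟨y, hy0, hyb, hy⟩ := exists_min_of_coercive (A := A + η • (1 : Matrix V V ℝ)) hη
    (fun x hx => by rw [hq]; linarith [hA.2 x hx]) b
  refine isSPN_of_min (hA.1.add (isSymm_one.smul η)) b (fun z hz => ?_) hy0 hyb ?_ hy
  · rw [hq]; linarith [hb z hz, hxx z]
  · rw [hq]; linarith [hA.2 y hy0, hxx y]

/-- A copositive matrix is SPN if it has a nonnegative zero that is positive at all but two of its
nonzero rows, and whose gradient vanishes at one of these two. -/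
theorem IsCopositive.isSPN_of_zero (hA : IsCopositive A) {u : V → ℝ} (hu : ∀ i, 0 ≤ u i)
    (hq : u ⬝ᵥ A *ᵥ u = 0) (b c : V)
    (hpos : ∀ i, i ≠ b → i ≠ c → 0 < u i ∨ ∀ j, A i j = 0) (hc : (A *ᵥ u) c = 0) :
    IsSPN A := by
  classical
  -- Changing `u` at the zero rows affects neither the gradient nor the form, and makes it positive
  -- off `b` and `c`.
  let w : V → ℝ := fun i => if ∀ j, A i j = 0 then 1 else u i
  have hw0 : ∀ i, 0 ≤ w i := fun i => by
    by_cases h : ∀ j, A i j = 0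
    · simp [w, h]
    · simpa [w, h] using hu i
  have hAw : A *ᵥ w = A *ᵥ u := by
    ext i
    refine Finset.sum_congr rfl fun j _ => ?_
    by_cases h : ∀ k, A j k = 0
    · simp [← hA.1.apply i j, h]
    · simp [w, h]
  have hwp : ∀ i, i ≠ b → i ≠ c → 0 < w i := fun i hib hic => by
    by_cases h : ∀ j, A i j = 0
    · simp [w, h]
    · simpa [w, h] using (hpos i hib hic).resolve_right h
  have hAw0 : ∀ i, i ≠ b → (A *ᵥ w) i = 0 := fun i hib => by
    rw [hAw]
    by_cases hic : i = c
    · rw [hic, hc]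
    rcases hpos i hib hic with h | h
    · exact hA.mulVec_eq_zero_of_pos hu hq h
    · exact Finset.sum_eq_zero fun j _ => by simp [h]
  have hqw : w ⬝ᵥ A *ᵥ w = 0 := by
    rw [hAw, hA.1.dotProduct_mulVec_comm, hAw, hq]
  refine hA.isSPN_of_forall_apply_eq_zero b fun z hz => ?_
  -- For large `t` the vector `z + t • w` is nonnegative, and the form has the same value there as
  -- at `z`, because `A *ᵥ w` vanishes off `b`. The sign of `z c` is free up to replacing `z` by
  -- `-z`.
  have key : ∀ z : V → ℝ, z b = 0 → 0 ≤ z c → 0 ≤ z ⬝ᵥ A *ᵥ z := by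
    intro z hz hzc
    have hex : ∃ t : ℝ, 0 ≤ t ∧ ∀ i, 0 ≤ z i + t * w i := by
      have h : ∀ i, ∀ᶠ t : ℝ in atTop, 0 ≤ z i + t * w i := fun i => by
        by_cases hi : i = b ∨ i = c
        · filter_upwards [eventually_ge_atTop (0 : ℝ)] with t ht
          have : 0 ≤ z i := by
            rcases hi with rfl | rfl
            · exact hz.ge
            · exact hzc
          exact add_nonneg this (mul_nonneg ht (hw0 i))
        · push Not at hi
          exact (tendsto_atTop_add_const_left _ _
            (tendsto_id.atTop_mul_const (hwp i hi.1 hi.2))).eventually_ge_atTop 0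
      exact ((eventually_ge_atTop (0 : ℝ)).and (eventually_all.2 h)).exists
    obtain ⟨t, -, ht⟩ := hex
    have h1 := hA.2 (z + t • w) (by simpa using ht)
    have h2 : z ⬝ᵥ A *ᵥ w = 0 := Finset.sum_eq_zero fun i _ => by
      by_cases hi : i = b
      · rw [hi, hz, zero_mul]
      · rw [hAw0 i hi, mul_zero]
    rwa [hA.1.dotProduct_mulVec_add_smul, h2, hqw, mul_zero, mul_zero, add_zero, add_zero] at h1
  rcases le_total 0 (z c) with h | h
  · exact key z hz h
  · simpa [mulVec_neg] using key (-z) (by simp [hz]) (by simpa using h)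

end Copositive

/-! ### Subtracting a positive entry, and Schur complements -/

section Pair

variable {V : Type*} [Fintype V] {A : Matrix V V ℝ}

/-- If no positive multiple of the form `x i * x j` can be subtracted from a copositive form, then
the form has a nonnegative zero that meets `{i, j}` and whose gradient vanishes on `{i, j}`. -/
theorem IsCopositive.exists_zero_of_pair (hA : IsCopositive A) (i j : V)
    (h : ∀ ε : ℝ, 0 < ε → ∃ x : V → ℝ, (∀ k, 0 ≤ x k) ∧ x ⬝ᵥ A *ᵥ x < ε * (x i * x j)) :
    ∃ u : V → ℝ, (∀ k, 0 ≤ u k) ∧ u ⬝ᵥ A *ᵥ u = 0 ∧ (A *ᵥ u) i = 0 ∧ (A *ᵥ u) j = 0 ∧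
      0 < u i + u j := by
  classical
  -- A minimal face `F` of the orthant on which every `ε` fails: for small `ε`, each violating
  -- vector supported in `F` is positive on all of `F`.
  let Q : Finset V → Prop := fun F => ∀ ε : ℝ, 0 < ε → ∃ x : V → ℝ, (∀ k, 0 ≤ x k) ∧
    (∀ k, k ∉ F → x k = 0) ∧ x ⬝ᵥ A *ᵥ x < ε * (x i * x j)
  obtain ⟨F, hF⟩ := exists_minimal_of_wellFoundedLT Q ⟨Finset.univ, fun ε hε => by
    obtain ⟨x, hx, hlt⟩ := h ε hε
    exact ⟨x, hx, by simp, hlt⟩⟩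
  -- proper faces of `F` are harmless for small `ε`
  have hface : ∀ᶠ ε : ℝ in 𝓝[>] 0, ∀ l ∈ F, ∀ x : V → ℝ, (∀ k, 0 ≤ x k) →
      (∀ k, k ∉ F.erase l → x k = 0) → ε * (x i * x j) ≤ x ⬝ᵥ A *ᵥ x := by
    rw [Filter.eventually_all_finset]
    intro l hl
    have hnot : ¬ Q (F.erase l) := fun hQ =>
      absurd (hF.2 hQ (Finset.erase_subset l F) hl) (Finset.notMem_erase l F)
    simp only [Q] at hnot
    push Not at hnot
    obtain ⟨ε₀, hε₀, h₀⟩ := hnot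
    filter_upwards [Ioo_mem_nhdsGT hε₀] with ε hε x hx hxF
    exact (mul_le_mul_of_nonneg_right hε.2.le (mul_nonneg (hx i) (hx j))).trans (h₀ x hx hxF)
  -- a zero supported in `F`
  obtain ⟨u, hu0, huF, huq, hune⟩ : ∃ u : V → ℝ, (∀ k, 0 ≤ u k) ∧ (∀ k, k ∉ F → u k = 0) ∧
      u ⬝ᵥ A *ᵥ u = 0 ∧ ∑ k, u k = 1 := by
    have hnorm : ∀ x : V → ℝ, (∀ k, 0 ≤ x k) → 0 < x i * x j → 0 < ∑ k, x k := fun x hx hxx =>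
      Finset.sum_pos' (fun k _ => hx k) ⟨i, Finset.mem_univ i,
        (hx i).lt_of_ne fun h0 => by rw [← h0, zero_mul] at hxx; exact hxx.false⟩
    have hpos : ∀ ε : ℝ, 0 < ε → ∀ x : V → ℝ, (∀ k, 0 ≤ x k) →
        x ⬝ᵥ A *ᵥ x < ε * (x i * x j) → 0 < x i * x j := fun ε hε x hx hlt =>
      (mul_pos_iff_of_pos_left hε).1 ((hA.2 x hx).trans_lt hlt)
    let K : Set (V → ℝ) := stdSimplex ℝ V ∩ {x | ∀ k, k ∉ F → x k = 0}
    have hKc : IsCompact K := (isCompact_stdSimplex ℝ V).inter_right <| by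
      simp only [Set.ofPred_forall]
      exact isClosed_iInter fun k => isClosed_iInter fun _ =>
        isClosed_eq (continuous_apply k) continuous_const
    have hscale : ∀ x : V → ℝ, (∀ k, 0 ≤ x k) → (∀ k, k ∉ F → x k = 0) → 0 < ∑ k, x k →
        (∑ k, x k)⁻¹ • x ∈ K := fun x hx hxF hs =>
      ⟨⟨fun k => mul_nonneg (inv_nonneg.2 hs.le) (hx k), by
        simp only [Pi.smul_apply, smul_eq_mul, ← Finset.mul_sum]
        exact inv_mul_cancel₀ hs.ne'⟩, fun k hk => by simp [hxF k hk]⟩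
    obtain ⟨x₀, hx₀, hx₀F, hlt₀⟩ := hF.1 1 one_pos
    obtain ⟨u, huK, humin⟩ := hKc.exists_isMinOn
      ⟨_, hscale x₀ hx₀ hx₀F (hnorm x₀ hx₀ (hpos 1 one_pos x₀ hx₀ hlt₀))⟩
      (continuous_dotProduct_mulVec A).continuousOn
    refine ⟨u, huK.1.1, huK.2, ?_, huK.1.2⟩
    -- A positive minimum `μ` on the simplex would give, by homogeneity, `x ⬝ᵥ A *ᵥ x ≥ μ * (∑ k, x
    -- k) ^ 2 ≥ μ * (x i * x j)`, against the failure at `ε = μ`.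
    by_contra hne
    have hμ : 0 < u ⬝ᵥ A *ᵥ u := (hA.2 u huK.1.1).lt_of_ne' hne
    obtain ⟨x, hx, hxF, hlt⟩ := hF.1 _ hμ
    have hs := hnorm x hx (hpos _ hμ x hx hlt)
    have h1 := humin (hscale x hx hxF hs)
    simp only [Set.mem_ofPred_eq, mulVec_smul, smul_dotProduct, dotProduct_smul, smul_eq_mul] at h1
    set σ := ∑ k, x k with hσ
    have hi : x i ≤ σ := Finset.single_le_sum (fun k _ => hx k) (Finset.mem_univ i)
    have hj : x j ≤ σ := Finset.single_le_sum (fun k _ => hx k) (Finset.mem_univ j)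
    have h2 : σ * σ * (u ⬝ᵥ A *ᵥ u) ≤ x ⬝ᵥ A *ᵥ x := by
      have h3 := mul_le_mul_of_nonneg_left h1 (mul_pos hs hs).le
      have h4 : σ * σ * (σ⁻¹ * (σ⁻¹ * (x ⬝ᵥ A *ᵥ x))) = x ⬝ᵥ A *ᵥ x := by
        field_simp
      linarith
    have h5 : x i * x j ≤ σ * σ := mul_le_mul hi hj (hx j) hs.le
    have h6 := mul_le_mul_of_nonneg_right h5 hμ.le
    linarith
  have hg := hA.mulVec_nonneg_of_zero hu0 huq
  -- Move a violating `x` along `-u` until a first coordinate `l` vanishes, at `s = x l / u l`. The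
  -- inequality on the proper face reached there, compared with the violation at `x`, bounds the
  -- pairing of `x` with the gradient at `u`.
  have hev : ∀ᶠ ε : ℝ in 𝓝[>] 0, ∃ x : V → ℝ, (∀ k, 0 ≤ x k) ∧ 0 < x i ∧ 0 < x j ∧
      x ⬝ᵥ A *ᵥ u < ε * (u i * x j + u j * x i) := by
    filter_upwards [hface, self_mem_nhdsWithin] with ε hε hε0
    have hε0 : 0 < ε := hε0
    obtain ⟨x, hx, hxF, hlt⟩ := hF.1 ε hε0
    have hxx : 0 < x i * x j := (mul_pos_iff_of_pos_left hε0).1 ((hA.2 x hx).trans_lt hlt)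
    have hxi : 0 < x i := (hx i).lt_of_ne fun h0 => by rw [← h0, zero_mul] at hxx; exact hxx.false
    have hxj : 0 < x j := (hx j).lt_of_ne fun h0 => by rw [← h0, mul_zero] at hxx; exact hxx.false
    have hxpos : ∀ l ∈ F, 0 < x l := fun l hl => (hx l).lt_of_ne fun h0 => by
      refine absurd (hε l hl x hx fun k hk => ?_) hlt.not_ge
      by_cases hkl : k = l
      · rw [hkl, ← h0]
      · exact hxF k fun hkF => hk (Finset.mem_erase.2 ⟨hkl, hkF⟩)
    obtain ⟨l, hl, hlmin⟩ : ∃ l ∈ Finset.univ.filter (fun k => 0 < u k),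
        ∀ k ∈ Finset.univ.filter (fun k => 0 < u k), x l / u l ≤ x k / u k := by
      refine Finset.exists_min_image _ _ ?_
      by_contra hemp
      rw [Finset.not_nonempty_iff_eq_empty, Finset.filter_eq_empty_iff] at hemp
      have : ∑ k, u k = 0 := Finset.sum_eq_zero fun k hk =>
        le_antisymm (not_lt.1 (hemp hk)) (hu0 k)
      linarith
    have hul : 0 < u l := (Finset.mem_filter.1 hl).2
    have hlF : l ∈ F := by
      by_contra hlF
      exact hul.ne' (huF l hlF)
    set s := x l / u l with hs
    have hs0 : 0 < s := div_pos (hxpos l hlF) hul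
    have hw := hε l hlF (x + (-s) • u) (fun k => by
      rcases (hu0 k).eq_or_lt with h0 | hk
      · simpa [← h0] using hx k
      · have h1 := (le_div_iff₀ hk).1 (hlmin k (Finset.mem_filter.2 ⟨Finset.mem_univ k, hk⟩))
        simpa using h1) (fun k hk => by
      by_cases hkl : k = l
      · rw [hkl]
        simp [hs, div_mul_cancel₀ _ hul.ne']
      · have hkF : k ∉ F := fun hkF => hk (Finset.mem_erase.2 ⟨hkl, hkF⟩)
        simp [hxF k hkF, huF k hkF])
    rw [hA.1.dotProduct_mulVec_add_smul, huq] at hw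
    simp only [Pi.add_apply, Pi.smul_apply, smul_eq_mul] at hw
    refine ⟨x, hx, hxi, hxj, ?_⟩
    have hxAu : 0 ≤ x ⬝ᵥ A *ᵥ u := Finset.sum_nonneg fun k _ => mul_nonneg (hx k) (hg k)
    have h7 : 0 ≤ ε * (s ^ 2 * (u i * u j)) := by
      have := mul_nonneg (hu0 i) (hu0 j)
      positivity
    have h8 : s * (2 * (x ⬝ᵥ A *ᵥ u)) < s * (ε * (u i * x j + u j * x i)) := by nlinarith
    have h9 := lt_of_mul_lt_mul_left h8 hs0.le
    linarith
  have hsum : 0 < u i + u j := by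
    obtain ⟨ε, ⟨x, hx, -, -, hlt⟩, hε⟩ := (hev.and self_mem_nhdsWithin).exists
    have hε : 0 < ε := hε
    have hxAu : 0 ≤ x ⬝ᵥ A *ᵥ u := Finset.sum_nonneg fun k _ => mul_nonneg (hx k) (hg k)
    by_contra! hle
    have hi : u i = 0 := by linarith [hu0 i, hu0 j]
    have hj : u j = 0 := by linarith [hu0 i, hu0 j]
    rw [hi, hj] at hlt
    simp only [zero_mul, add_zero, mul_zero] at hlt
    linarith
  -- As the gradient is nonnegative, `x a * (A *ᵥ u) a < ε * (u b * x a)`; cancel `x a` and let `ε`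
  -- tend to zero.
  have hgrad : ∀ a b : V, u a = 0 → (∀ᶠ ε : ℝ in 𝓝[>] 0, ∃ x : V → ℝ, (∀ k, 0 ≤ x k) ∧
      0 < x a ∧ x ⬝ᵥ A *ᵥ u < ε * (u b * x a)) → (A *ᵥ u) a = 0 := by
    intro a b ha hab
    by_contra hne
    have hga : 0 < (A *ᵥ u) a := (hg a).lt_of_ne' hne
    have hub := hu0 b
    obtain ⟨ε, ⟨x, hx, hxa, hlt⟩, hε⟩ :=
      (hab.and (Ioo_mem_nhdsGT (div_pos hga (by linarith : 0 < u b + 1)))).exists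
    have h1 : x a * (A *ᵥ u) a ≤ x ⬝ᵥ A *ᵥ u :=
      Finset.single_le_sum (f := fun k => x k * (A *ᵥ u) k)
        (fun k _ => mul_nonneg (hx k) (hg k)) (Finset.mem_univ a)
    have h2 : ε * (u b + 1) < (A *ᵥ u) a := (lt_div_iff₀ (by linarith)).1 hε.2
    have h3 : ε * u b < (A *ᵥ u) a := by nlinarith [hε.1]
    nlinarith
  refine ⟨u, hu0, huq, ?_, ?_, hsum⟩
  · rcases (hu0 i).eq_or_lt with h0 | hi
    · refine hgrad i j h0.symm (hev.mono ?_)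
      rintro ε ⟨x, hx, hxi, -, hlt⟩
      exact ⟨x, hx, hxi, by simpa [← h0] using hlt⟩
    · exact hA.mulVec_eq_zero_of_pos hu0 huq hi
  · rcases (hu0 j).eq_or_lt with h0 | hj
    · refine hgrad j i h0.symm (hev.mono ?_)
      rintro ε ⟨x, hx, -, hxj, hlt⟩
      exact ⟨x, hx, hxj, by simpa [← h0] using hlt⟩
    · exact hA.mulVec_eq_zero_of_pos hu0 huq hj

/-- The symmetric matrix of the quadratic form `2 * x i * x j`. -/
def pairMatrix {V : Type*} [DecidableEq V] (i j : V) : Matrix V V ℝ :=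
  single i j 1 + single j i 1

theorem dotProduct_pairMatrix_mulVec [DecidableEq V] (i j : V) (x : V → ℝ) :
    x ⬝ᵥ pairMatrix i j *ᵥ x = 2 * (x i * x j) := by
  have h : ∀ a b : V, x ⬝ᵥ single a b (1 : ℝ) *ᵥ x = x a * x b := fun a b => by
    rw [single_mulVec_eq]
    simp [mul_comm]
  rw [pairMatrix, add_mulVec, dotProduct_add, h, h]
  ring

theorem pairMatrix_isSymm {V : Type*} [DecidableEq V] (i j : V) : (pairMatrix i j).IsSymm := by
  ext a b
  simp only [pairMatrix, transpose_apply, Matrix.add_apply, single_apply]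
  rw [add_comm]
  congr 1 <;> exact if_congr and_comm rfl rfl

theorem pairMatrix_nonneg {V : Type*} [DecidableEq V] (i j a b : V) : 0 ≤ pairMatrix i j a b := by
  simp only [pairMatrix, Matrix.add_apply, single_apply]
  split_ifs <;> norm_num

/-- To show that the copositive matrices with a given support are SPN, the entries of one row may
be assumed nonpositive off the diagonal, or else the matrix has a nonnegative zero adapted to a
positive entry of this row. -/
theorem IsCopositive.isSPN_of_row (E : V → V → Prop) (i : V)
    (hpos : ∀ A : Matrix V V ℝ, IsCopositive A → (∀ x y, A x y ≠ 0 → E x y) → ∀ j, j ≠ i →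
      0 < A i j → ∀ u : V → ℝ, (∀ k, 0 ≤ u k) → u ⬝ᵥ A *ᵥ u = 0 → (A *ᵥ u) i = 0 →
      (A *ᵥ u) j = 0 → 0 < u i + u j → IsSPN A)
    (hneg : ∀ A : Matrix V V ℝ, IsCopositive A → (∀ x y, A x y ≠ 0 → E x y) →
      (∀ j, j ≠ i → A i j ≤ 0) → IsSPN A)
    (hA : IsCopositive A) (hE : ∀ x y, A x y ≠ 0 → E x y) : IsSPN A := by
  classical
  -- The induction is on the number of positive off-diagonal entries in row `i`, which drops when
  -- one of them is subtracted completely.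
  induction hn : (Finset.univ.filter fun j => j ≠ i ∧ 0 < A i j).card using
    Nat.strong_induction_on generalizing A with
  | _ n ih =>
  subst hn
  by_cases hall : ∀ j, j ≠ i → A i j ≤ 0
  · exact hneg A hA hE hall
  push Not at hall
  obtain ⟨j, hji, hij⟩ := hall
  let T : Set ℝ := Set.Icc 0 (A i j) ∩
    {t | ∀ x : V → ℝ, (∀ k, 0 ≤ x k) → 0 ≤ x ⬝ᵥ A *ᵥ x - t * (2 * (x i * x j))}
  have hT : IsCompact T := isCompact_Icc.inter_right <| by
    simp only [Set.ofPred_forall]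
    exact isClosed_iInter fun x => isClosed_iInter fun _ =>
      isClosed_le continuous_const (by fun_prop)
  obtain ⟨t, ht, htmax⟩ := hT.exists_isGreatest ⟨0, ⟨⟨le_rfl, hij.le⟩, fun x hx => by
    simpa using hA.2 x hx⟩⟩
  set B := A - t • pairMatrix i j with hB
  have hBq : ∀ x : V → ℝ, x ⬝ᵥ B *ᵥ x = x ⬝ᵥ A *ᵥ x - t * (2 * (x i * x j)) := fun x => by
    rw [hB, sub_mulVec, dotProduct_sub, smul_mulVec, dotProduct_smul,
      dotProduct_pairMatrix_mulVec, smul_eq_mul]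
  have hBs : (t • pairMatrix i j).IsSymm := (pairMatrix_isSymm i j).smul t
  have hBc : IsCopositive B := ⟨hA.1.sub hBs, fun x hx => by rw [hBq]; exact ht.2 x hx⟩
  have hBE : ∀ x y, B x y ≠ 0 → E x y := fun x y hxy => hE x y fun h0 => hxy <| by
    have hn1 : ¬ (i = x ∧ j = y) := by
      rintro ⟨rfl, rfl⟩
      exact hij.ne' h0
    have hn2 : ¬ (j = x ∧ i = y) := by
      rintro ⟨rfl, rfl⟩
      rw [hA.1.apply] at h0
      exact hij.ne' h0
    simp [hB, pairMatrix, h0, hn1, hn2]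
  have hBA : A = B + t • pairMatrix i j := by simp [hB]
  have hBij : B i j = A i j - t := by
    simp [hB, pairMatrix, hji]
  rw [hBA]
  refine IsSPN.add_nonneg ?_ hBs fun a b => mul_nonneg ht.1.1 (pairMatrix_nonneg i j a b)
  rcases ht.1.2.eq_or_lt with hteq | htlt
  · refine ih _ (Finset.card_lt_card ?_) hBc hBE rfl
    refine Finset.ssubset_iff_subset_ne.2 ⟨fun k hk => ?_, fun heq => ?_⟩
    · obtain ⟨hki, hk⟩ := (Finset.mem_filter.1 hk).2
      refine Finset.mem_filter.2 ⟨Finset.mem_univ k, hki, ?_⟩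
      have : B i k ≤ A i k := by
        have := mul_nonneg ht.1.1 (pairMatrix_nonneg i j i k)
        simpa [hB] using this
      linarith
    · have hj : j ∈ Finset.univ.filter fun j => j ≠ i ∧ 0 < A i j :=
        Finset.mem_filter.2 ⟨Finset.mem_univ j, hji, hij⟩
      rw [← heq] at hj
      have := (Finset.mem_filter.1 hj).2.2
      rw [hBij] at this
      linarith
  · obtain ⟨u, hu, huq, hui, huj, hus⟩ := hBc.exists_zero_of_pair i j fun ε hε => by
      by_contra! hno
      -- The pair form is `2 * (x i * x j)`, hence the half. If `ε` never failed, this larger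
      -- multiple could also be subtracted.
      set t' := min (t + ε / 2) (A i j) with ht'
      have htt' : t < t' := lt_min (by linarith) htlt
      refine absurd (htmax ⟨⟨ht.1.1.trans htt'.le, min_le_right _ _⟩, fun x hx => ?_⟩)
        htt'.not_ge
      have h1 := hno x hx
      rw [hBq] at h1
      have h2 : t' ≤ t + ε / 2 := min_le_left _ _
      have h3 := mul_le_mul_of_nonneg_right h2 (mul_nonneg (hx i) (hx j))
      linarith
    exact hpos B hBc hBE j hji (by rw [hBij]; linarith) u hu huq hui huj hus

/-- The Schur complement, with the row and column of the pivot kept as zeros. -/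
noncomputable def schurMatrix {V : Type*} (A : Matrix V V ℝ) (i : V) : Matrix V V ℝ :=
  of fun x y => A x y - A i x * A i y / A i i

/-- With a zero diagonal entry the `i`-th unit vector is a zero of the form, so its gradient, which
is row `i`, is nonnegative. -/
theorem IsCopositive.apply_eq_zero_of_nonpos (hA : IsCopositive A) {i j : V} (hii : A i i = 0)
    (hij : A i j ≤ 0) : A i j = 0 := by
  classical
  have h := hA.mulVec_nonneg_of_zero (u := Pi.single i 1) (single_one_nonneg i)
    (by simpa using hii) j
  have h' : 0 ≤ A j i := by simpa using h
  rw [hA.1.apply] at h'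
  exact le_antisymm hij h'

theorem dotProduct_schurMatrix_mulVec (i : V) (x : V → ℝ) :
    x ⬝ᵥ schurMatrix A i *ᵥ x = x ⬝ᵥ A *ᵥ x - (A *ᵥ x) i ^ 2 / A i i := by
  have h : schurMatrix A i = A - (A i i)⁻¹ • vecMulVec (A i) (A i) := by
    ext a b
    simp [schurMatrix, vecMulVec_apply, div_eq_inv_mul]
  have h1 : A i ⬝ᵥ x = (A *ᵥ x) i := rfl
  rw [h, sub_mulVec, smul_mulVec, vecMulVec_mulVec, dotProduct_sub, dotProduct_smul,
    dotProduct_smul, dotProduct_comm x (A i), h1, MulOpposite.smul_eq_mul_unop, MulOpposite.unop_op,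
    smul_eq_mul]
  ring

theorem schurMatrix_isSymm {V : Type*} {A : Matrix V V ℝ} (hA : A.IsSymm) (i : V) : (schurMatrix A i).IsSymm := by
  ext a b
  simp only [schurMatrix, transpose_apply, of_apply, hA.apply a b]
  ring

/-- For a zero pivot the division by zero makes the Schur complement equal to `A`, whose row `i` is
then already zero. -/
theorem IsCopositive.schurMatrix_apply_left (hA : IsCopositive A) {i : V}
    (hi : ∀ j, j ≠ i → A i j ≤ 0) (j : V) : schurMatrix A i i j = 0 := by
  rcases eq_or_ne (A i i) 0 with h0 | h0
  · have : A i j = 0 := by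
      by_cases hj : j = i
      · rw [hj, h0]
      · exact hA.apply_eq_zero_of_nonpos h0 (hi j hj)
    simp [schurMatrix, h0, this]
  · simp [schurMatrix, mul_div_cancel_left₀ _ h0]

/-- For a positive pivot, the value at `x` is the minimum of the form of `A` over the `i`-th
coordinate. The sign condition on row `i` makes the minimizing coordinate nonnegative, so
copositivity of `A` applies there. -/
theorem IsCopositive.isCopositive_schurMatrix (hA : IsCopositive A) {i : V}
    (hi : ∀ j, j ≠ i → A i j ≤ 0) : IsCopositive (schurMatrix A i) := by
  classical
  refine ⟨schurMatrix_isSymm hA.1 i, fun x hx => ?_⟩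
  rcases (hA.diag_nonneg i).eq_or_lt with h0 | hpos
  · rw [dotProduct_schurMatrix_mulVec, ← h0]
    simpa using hA.2 x hx
  set r := (A *ᵥ x) i with hr
  have hr' : r - A i i * x i ≤ 0 := by
    have : r - A i i * x i = ∑ j ∈ Finset.univ.erase i, A i j * x j := by
      rw [hr, sub_eq_iff_eq_add', mulVec, dotProduct,
        Finset.add_sum_erase _ (fun j => A i j * x j) (Finset.mem_univ i)]
    rw [this]
    exact Finset.sum_nonpos fun j hj =>
      mul_nonpos_of_nonpos_of_nonneg (hi j (Finset.ne_of_mem_erase hj)) (hx j)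
  have hy := hA.2 (x + (-(r / A i i)) • Pi.single i 1) fun k => by
    by_cases hk : k = i
    · subst hk
      have : r / A k k ≤ x k := by rw [div_le_iff₀ hpos]; linarith
      simpa using this
    · simpa [hk] using hx k
  rw [hA.1.dotProduct_mulVec_add_smul, hA.1.dotProduct_mulVec_comm x (Pi.single i 1),
    single_one_dotProduct, single_one_dotProduct, ← hr] at hy
  have h2 : (A *ᵥ Pi.single i 1) i = A i i := by simp
  rw [h2] at hy
  rw [dotProduct_schurMatrix_mulVec, ← hr]
  convert hy using 1
  field_simp
  ring

/-- The difference of the two forms is the square `(A *ᵥ x) i ^ 2 / A i i`, read as zero for a zero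
pivot. -/
theorem IsCopositive.isSPN_of_schurMatrix (hA : IsCopositive A) (i : V)
    (h : IsSPN (schurMatrix A i)) : IsSPN A := by
  have hP : (A - schurMatrix A i).PosSemidef :=
    posSemidef_of_isSymm (hA.1.sub (schurMatrix_isSymm hA.1 i)) fun x => by
      rw [sub_mulVec, dotProduct_sub, dotProduct_schurMatrix_mulVec, sub_sub_cancel]
      exact div_nonneg (sq_nonneg _) (hA.diag_nonneg i)
  simpa using hP.add_isSPN h

end Pair

/-! ### Order at most four -/

section SmallOrder

variable {V : Type*} [Fintype V] {A : Matrix V V ℝ}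

/-- Copositive matrices of order at most four are SPN. -/
theorem IsCopositive.isSPN_of_card_le_four (hA : IsCopositive A) (s : Finset V)
    (hs : s.card ≤ 4) (hE : ∀ x y, A x y ≠ 0 → x ∈ s ∧ y ∈ s) : IsSPN A := by
  classical
  induction s using Finset.strongInduction generalizing A with
  | H s ih =>
  rcases s.eq_empty_or_nonempty with rfl | ⟨i, his⟩
  · have : A = 0 := by
      ext x y
      by_contra h
      simpa using hE x y h
    exact this ▸ PosSemidef.zero.isSPN
  refine IsCopositive.isSPN_of_row (fun x y => x ∈ s ∧ y ∈ s) i ?_ ?_ hA hE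
  · intro A hA hE j hji hij u hu huq hui huj hus
    have hjs : j ∈ s := (hE i j hij.ne').2
    have hji' : 0 < A j i := by rwa [hA.1.apply]
    -- Were `u` supported on `{i, j}`, the vanishing gradients at `i` and `j` would be sums of
    -- nonnegative terms and force `u i = u j = 0`.
    obtain ⟨k, hks, hki, hkj, hk⟩ : ∃ k ∈ s, k ≠ i ∧ k ≠ j ∧ 0 < u k := by
      by_contra! hno
      have hsum : ∀ a, (A *ᵥ u) a = A a i * u i + A a j * u j := fun a => by
        rw [← Finset.sum_pair (f := fun k => A a k * u k) hji.symm]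
        refine (Finset.sum_subset (Finset.subset_univ _) fun k _ hk => ?_).symm
        simp only [Finset.mem_insert, Finset.mem_singleton, not_or] at hk
        by_cases hks : k ∈ s
        · rw [le_antisymm (hno k hks hk.1 hk.2) (hu k), mul_zero]
        · by_contra hne
          exact hks (hE a k (left_ne_zero_of_mul hne)).2
      rw [hsum] at hui huj
      have h1 := mul_nonneg (hA.diag_nonneg i) (hu i)
      have h2 := mul_nonneg (hA.diag_nonneg j) (hu j)
      have h3 := mul_nonneg hij.le (hu j)
      have h4 := mul_nonneg hji'.le (hu i)
      have h5 : u j = 0 := (mul_eq_zero.1 (by linarith : A i j * u j = 0)).resolve_left hij.ne'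
      have h6 : u i = 0 := (mul_eq_zero.1 (by linarith : A j i * u i = 0)).resolve_left hji'.ne'
      linarith
    have hcard : (((s.erase i).erase j).erase k).card ≤ 1 := by
      rw [Finset.card_erase_of_mem (by simp [hks, hki, hkj]),
        Finset.card_erase_of_mem (by simp [hjs, hji]), Finset.card_erase_of_mem his]
      omega
    -- At most one index `b` is left uncontrolled. The other exception allowed by `isSPN_of_zero` is
    -- whichever of `i` and `j` may lie outside the support of `u`.
    obtain ⟨b, hb⟩ : ∃ b, ∀ x ∈ s, x ≠ i → x ≠ j → x ≠ k → x = b := by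
      rcases (((s.erase i).erase j).erase k).eq_empty_or_nonempty with h0 | ⟨b, hb⟩
      · refine ⟨i, fun x hx h1 h2 h3 => absurd h0 ?_⟩
        exact Finset.ne_empty_of_mem (a := x) (by simp [hx, h1, h2, h3])
      · exact ⟨b, fun x hx h1 h2 h3 => Finset.card_le_one.1 hcard x (by simp [hx, h1, h2, h3]) b hb⟩
    have hfin : ∀ c, (A *ᵥ u) c = 0 → (∀ x, (x = i ∨ x = j) → x ≠ c → 0 < u x) → IsSPN A :=
      fun c hc hx => hA.isSPN_of_zero hu huq b c (fun x hxb hxc => by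
        by_cases hxs : x ∈ s
        · left
          by_cases h1 : x = i
          · exact hx x (.inl h1) hxc
          by_cases h2 : x = j
          · exact hx x (.inr h2) hxc
          by_cases h3 : x = k
          · rwa [h3]
          exact absurd (hb x hxs h1 h2 h3) hxb
        · right
          intro y
          by_contra hne
          exact hxs (hE x y hne).1) hc
    rcases (hu i).eq_or_lt with h0 | h0
    · refine hfin i hui ?_
      rintro x (rfl | rfl) hne
      · exact absurd rfl hne
      · linarith
    · refine hfin j huj ?_
      rintro x (rfl | rfl) hne
      · exact h0
      · exact absurd rfl hne
  · intro A hA hE hi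
    refine hA.isSPN_of_schurMatrix i (ih (s.erase i) (Finset.erase_ssubset his)
      (hA.isCopositive_schurMatrix hi) ((Finset.card_erase_le).trans hs) fun x y hxy => ?_)
    have hx : x ≠ i := by
      rintro rfl
      exact hxy (hA.schurMatrix_apply_left hi y)
    have hy : y ≠ i := by
      rintro rfl
      rw [(schurMatrix_isSymm hA.1 y).apply] at hxy
      exact hxy (hA.schurMatrix_apply_left hi x)
    have hxys : x ∈ s ∧ y ∈ s := by
      by_cases h : A x y = 0
      · have h1 : A i x ≠ 0 := fun h0 => hxy (by simp [schurMatrix, h, h0])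
        have h2 : A i y ≠ 0 := fun h0 => hxy (by simp [schurMatrix, h, h0])
        exact ⟨(hE i x h1).2, (hE i y h2).2⟩
      · exact hE x y h
    exact ⟨Finset.mem_erase.2 ⟨hx, hxys.1⟩, Finset.mem_erase.2 ⟨hy, hxys.2⟩⟩

end SmallOrder

/-! ### Cutting a zero along a positive edge -/

section Bridge

variable {V : Type*} [Fintype V] {A : Matrix V V ℝ}

/-- A nonnegative zero whose gradient vanishes at the ends of a positive edge `i j` vanishes at
`i` and `j` if this edge is the only one in its support across a cut. -/
theorem IsCopositive.false_of_bridge (hA : IsCopositive A) {u : V → ℝ} (hu : ∀ k, 0 ≤ u k)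
    (hq : u ⬝ᵥ A *ᵥ u = 0) {i j : V} (hij : 0 < A i j) (hui : (A *ᵥ u) i = 0)
    (huj : (A *ᵥ u) j = 0) (hus : 0 < u i + u j) (W : Set V) (hiW : i ∉ W) (hjW : j ∈ W)
    (hW : ∀ x y, x ∉ W → y ∈ W → A x y ≠ 0 → (x = i ∧ y = j) ∨ (x ≠ i ∧ u x = 0)) : False := by
  classical
  -- Split `u = w + v` along the cut. The cross term `A i j * u i * u j` is nonnegative, so `w` and
  -- `v` are zeros too and have nonnegative gradients. Then `0 = (A *ᵥ w) i + A i j * u j` forces `u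
  -- j = 0`, and symmetrically `u i = 0`.
  let v : V → ℝ := fun x => if x ∈ W then u x else 0
  let w : V → ℝ := fun x => if x ∈ W then 0 else u x
  have huvw : u = w + v := by
    ext x
    by_cases h : x ∈ W <;> simp [v, w, h]
  have hv : ∀ k, 0 ≤ v k := fun k => by
    simp only [v]
    split_ifs
    exacts [hu k, le_rfl]
  have hw : ∀ k, 0 ≤ w k := fun k => by
    simp only [w]
    split_ifs
    exacts [le_rfl, hu k]
  have hAv : (A *ᵥ v) i = A i j * u j := by
    refine (Finset.sum_eq_single j (fun y _ hyj => ?_) (by simp)).trans (by simp [v, hjW])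
    by_cases hy : y ∈ W
    · have : A i y = 0 := by
        by_contra hne
        rcases hW i y hiW hy hne with h | h
        · exact hyj h.2
        · exact h.1 rfl
      simp [this]
    · simp [v, hy]
  have hAw : (A *ᵥ w) j = A i j * u i := by
    refine (Finset.sum_eq_single i (fun x _ hxi => ?_) (by simp)).trans
      (by simp [w, hiW, hA.1.apply i j])
    by_cases hx : x ∈ W
    · simp [w, hx]
    · by_cases h0 : A x j = 0
      · simp [hA.1.apply x j, h0]
      · rcases hW x j hx hjW h0 with h | h
        · exact absurd h.1 hxi
        · simp [w, h.2]
  have hcross : w ⬝ᵥ A *ᵥ v = u i * (A i j * u j) := by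
    rw [← hAv]
    refine (Finset.sum_eq_single i (fun x _ hxi => ?_) (by simp)).trans (by simp [w, hiW])
    by_cases hx : x ∈ W
    · simp [w, hx]
    · by_cases h0 : u x = 0
      · simp [w, h0]
      · have : (A *ᵥ v) x = 0 := Finset.sum_eq_zero fun y _ => by
          by_cases hy : y ∈ W
          · have : A x y = 0 := by
              by_contra hne
              rcases hW x y hx hy hne with h | h
              · exact hxi h.1
              · exact h0 h.2
            simp [this]
          · simp [v, hy]
        rw [this, mul_zero]
  have hsum := hA.1.dotProduct_mulVec_add w v
  rw [← huvw, hq, hcross] at hsum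
  have h1 := hA.2 w hw
  have h2 := hA.2 v hv
  have h3 : 0 ≤ u i * (A i j * u j) := mul_nonneg (hu i) (mul_nonneg hij.le (hu j))
  have hqw : w ⬝ᵥ A *ᵥ w = 0 := by linarith
  have hqv : v ⬝ᵥ A *ᵥ v = 0 := by linarith
  have e : ∀ k, (A *ᵥ u) k = (A *ᵥ w) k + (A *ᵥ v) k := fun k => by
    rw [huvw, mulVec_add, Pi.add_apply]
  have ei := e i
  have ej := e j
  rw [hui, hAv] at ei
  rw [huj, hAw] at ej
  have h4 := hA.mulVec_nonneg_of_zero hw hqw i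
  have h5 := hA.mulVec_nonneg_of_zero hv hqv j
  have h6 := mul_nonneg hij.le (hu i)
  have h7 := mul_nonneg hij.le (hu j)
  have h8 : A i j * (u i + u j) = 0 := by linarith
  exact (mul_pos hij hus).ne' h8

end Bridge

/-! ### Induction along the path -/

section Path

variable {V : Type*} [Fintype V] {A : Matrix V V ℝ}

/-- The edges, up to orientation and with loops, of a path `p 0, …, p m` whose ends are joined to
two adjacent vertices `a` and `b`. -/
def pathRel {V : Type*} (p : ℕ → V) (m : ℕ) (a b : V) (x y : V) : Prop :=
  (∃ k ≤ m, x = p k ∧ y = p k) ∨ (∃ k < m, x = p k ∧ y = p (k + 1)) ∨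
    ((x = p 0 ∨ x = p m ∨ x = a ∨ x = b) ∧ (y = a ∨ y = b))

/-- A zero adapted to a positive edge of the path is positive on the rest of the path, and at one
of the two vertices outside the path. -/
theorem IsCopositive.isSPN_of_path_edge (hA : IsCopositive A) {p : ℕ → V} {m : ℕ} {a b : V}
    (hp : ∀ k ≤ m, ∀ l ≤ m, p k = p l → k = l) (hpa : ∀ k ≤ m, p k ≠ a) (hpb : ∀ k ≤ m, p k ≠ b)
    (hE : ∀ x y, A x y ≠ 0 → pathRel p m a b x y ∨ pathRel p m a b y x) {k : ℕ} (hk : k < m)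
    (hkk : 0 < A (p k) (p (k + 1))) {u : V → ℝ} (hu : ∀ i, 0 ≤ u i) (huq : u ⬝ᵥ A *ᵥ u = 0)
    (hu1 : (A *ᵥ u) (p k) = 0) (hu2 : (A *ᵥ u) (p (k + 1)) = 0)
    (hus : 0 < u (p k) + u (p (k + 1))) : IsSPN A := by
  have hmem : ∀ lo hi l, hi ≤ m → l ≤ m → (p l ∈ p '' Set.Icc lo hi ↔ lo ≤ l ∧ l ≤ hi) := by
    intro lo hi l hhi hl
    constructor
    · rintro ⟨l', ⟨h1, h2⟩, e⟩
      rw [← hp l' (h2.trans hhi) l hl e]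
      exact ⟨h1, h2⟩
    · exact fun h => ⟨l, h, rfl⟩
  have hsymm : 0 < A (p (k + 1)) (p k) := by rwa [hA.1.apply]
  have hus' : 0 < u (p (k + 1)) + u (p k) := by rwa [add_comm]
  have hnba : ∀ lo hi, hi ≤ m → a ∉ p '' Set.Icc lo hi := by
    rintro lo hi h ⟨l, hl, e⟩
    exact hpa l (hl.2.trans h) e
  have hnbb : ∀ lo hi, hi ≤ m → b ∉ p '' Set.Icc lo hi := by
    rintro lo hi h ⟨l, hl, e⟩
    exact hpb l (hl.2.trans h) e
  -- the edges leaving a segment of the path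
  have hcut : ∀ lo hi, hi < m → ∀ x l, x ∉ p '' Set.Icc lo hi → lo ≤ l → l ≤ hi →
      A x (p l) ≠ 0 → (x = p (hi + 1) ∧ l = hi) ∨ (l = lo ∧ ∃ j, lo = j + 1 ∧ x = p j) ∨
        (l = 0 ∧ (x = a ∨ x = b)) := by
    intro lo hi hhi x l hx hlo hl hne
    have hlm : l ≤ m := by omega
    rcases hE x (p l) hne with h | h
    · rcases h with ⟨j, hj, rfl, e⟩ | ⟨j, hj, rfl, e⟩ | ⟨-, h | h⟩
      · have := hp l hlm j hj e
        rw [hmem lo hi j (by omega) hj] at hx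
        omega
      · have := hp l hlm (j + 1) hj e
        rw [hmem lo hi j (by omega) (by omega)] at hx
        exact .inr (.inl ⟨by omega, j, by omega, rfl⟩)
      · exact absurd h (hpa l hlm)
      · exact absurd h (hpb l hlm)
    · rcases h with ⟨j, hj, e, rfl⟩ | ⟨j, hj, e, rfl⟩ | ⟨h | h | h | h, h'⟩
      · have := hp l hlm j hj e
        rw [hmem lo hi j (by omega) hj] at hx
        omega
      · have := hp l hlm j (by omega) e
        subst this
        rw [hmem lo hi (l + 1) (by omega) hj] at hx
        exact .inl ⟨by rw [show l = hi by omega], by omega⟩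
      · exact .inr (.inr ⟨hp l hlm 0 (by omega) h, h'⟩)
      · have := hp l hlm m le_rfl h
        omega
      · exact absurd h (hpa l hlm)
      · exact absurd h (hpb l hlm)
  -- If `u` vanished at `p l`, the segment between `p l` and the positive edge could be left only
  -- through `p l` or through that edge, which would then be a bridge in the support.
  have hpath : ∀ l ≤ m, l ≠ k → l ≠ k + 1 → 0 < u (p l) := by
    intro l hl h1 h2
    refine (hu _).lt_of_ne' fun h0 => ?_
    rcases lt_or_gt_of_ne h1 with hlt | hgt
    · refine hA.false_of_bridge hu huq hsymm hu2 hu1 hus' (p '' Set.Icc (l + 1) k)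
        (by rw [hmem _ _ _ (by omega) (by omega)]; omega)
        (by rw [hmem _ _ _ (by omega) (by omega)]; omega) ?_
      rintro x _ hx ⟨j, ⟨hj1, hj2⟩, rfl⟩ hne
      rcases hcut _ _ hk x j hx hj1 hj2 hne with ⟨rfl, rfl⟩ | ⟨rfl, i, hi, rfl⟩ | h
      · exact .inl ⟨rfl, rfl⟩
      · obtain rfl : l = i := by omega
        refine .inr ⟨fun e => ?_, h0⟩
        have := hp l hl (k + 1) (by omega) e
        omega
      · omega
    · refine hA.false_of_bridge hu huq hkk hu1 hu2 hus (p '' Set.Icc (k + 1) (l - 1))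
        (by rw [hmem _ _ _ (by omega) (by omega)]; omega)
        (by rw [hmem _ _ _ (by omega) (by omega)]; omega) ?_
      rintro x _ hx ⟨j, ⟨hj1, hj2⟩, rfl⟩ hne
      rcases hcut _ _ (by omega) x j hx hj1 hj2 hne with ⟨rfl, rfl⟩ | ⟨rfl, i, hi, rfl⟩ | h
      · rw [show l - 1 + 1 = l by omega]
        refine .inr ⟨fun e => ?_, h0⟩
        exact h1 (hp l hl k (by omega) e)
      · obtain rfl : k = i := by omega
        exact .inl ⟨rfl, rfl⟩
      · omega
  -- If `u` vanished at both, the initial segment ending at `p k` would be cut off in the same way.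
  have hab : 0 < u a ∨ 0 < u b := by
    by_contra! h
    have ha : u a = 0 := le_antisymm h.1 (hu a)
    have hb : u b = 0 := le_antisymm h.2 (hu b)
    refine hA.false_of_bridge hu huq hsymm hu2 hu1 hus' (p '' Set.Icc 0 k)
      (by rw [hmem _ _ _ (by omega) (by omega)]; omega)
      (by rw [hmem _ _ _ (by omega) (by omega)]; omega) ?_
    rintro x _ hx ⟨j, ⟨hj1, hj2⟩, rfl⟩ hne
    rcases hcut _ _ hk x j hx hj1 hj2 hne with ⟨rfl, rfl⟩ | ⟨-, i, hi, -⟩ | ⟨-, rfl | rfl⟩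
    · exact .inl ⟨rfl, rfl⟩
    · omega
    · exact .inr ⟨(hpa _ hk).symm, ha⟩
    · exact .inr ⟨(hpb _ hk).symm, hb⟩
  have hact : ∀ x y, A x y ≠ 0 → (∃ l ≤ m, x = p l) ∨ x = a ∨ x = b := by
    intro x y hne
    rcases hE x y hne with h | h
    · rcases h with ⟨j, hj, rfl, -⟩ | ⟨j, hj, rfl, -⟩ | ⟨h | h | h, -⟩
      · exact .inl ⟨j, hj, rfl⟩
      · exact .inl ⟨j, hj.le, rfl⟩
      · exact .inl ⟨0, by omega, h⟩
      · exact .inl ⟨m, le_rfl, h⟩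
      · exact .inr h
    · rcases h with ⟨j, hj, -, rfl⟩ | ⟨j, hj, -, rfl⟩ | ⟨-, h⟩
      · exact .inl ⟨j, hj, rfl⟩
      · exact .inl ⟨j + 1, hj, rfl⟩
      · exact .inr h
  -- The two exceptions for `isSPN_of_zero` are `d` and an end of the positive edge, where the
  -- gradient vanishes; the other end is chosen in the support.
  have hfin : ∀ c d, (c = a ∧ d = b ∨ c = b ∧ d = a) → 0 < u c → IsSPN A := by
    intro c d hcd hc
    have hrest : ∀ e, (A *ᵥ u) e = 0 → (∀ x, (x = p k ∨ x = p (k + 1)) → x ≠ e → 0 < u x) →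
        IsSPN A := fun e he hx => hA.isSPN_of_zero hu huq d e (fun x hxd hxe => by
      by_cases hz : ∀ y, A x y = 0
      · exact .inr hz
      left
      push Not at hz
      obtain ⟨y, hy⟩ := hz
      rcases hact x y hy with ⟨l, hl, rfl⟩ | h
      · by_cases h1 : l = k
        · exact hx _ (.inl (by rw [h1])) hxe
        by_cases h2 : l = k + 1
        · exact hx _ (.inr (by rw [h2])) hxe
        exact hpath l hl h1 h2
      · have : x = c := by
          rcases hcd with ⟨rfl, rfl⟩ | ⟨rfl, rfl⟩ <;> rcases h with rfl | rfl <;>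
            first | rfl | exact absurd rfl hxd
        rwa [this]) he
    rcases (hu (p k)).eq_or_lt with h0 | h0
    · refine hrest (p k) hu1 ?_
      rintro x (rfl | rfl) hne
      · exact absurd rfl hne
      · linarith
    · refine hrest (p (k + 1)) hu2 ?_
      rintro x (rfl | rfl) hne
      · exact h0
      · exact absurd rfl hne
  rcases hab with h | h
  · exact hfin a b (.inl ⟨rfl, rfl⟩) h
  · exact hfin b a (.inr ⟨rfl, rfl⟩) h

/-- The neighbours of the second vertex of the path. -/
theorem pathRel_second {V : Type*} {p : ℕ → V} {m : ℕ} {a b : V} (hm : 2 ≤ m)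
    (hp : ∀ k ≤ m, ∀ l ≤ m, p k = p l → k = l) (hpa : ∀ k ≤ m, p k ≠ a) (hpb : ∀ k ≤ m, p k ≠ b)
    {y : V} (hy : y ≠ p 1) (h : pathRel p m a b (p 1) y ∨ pathRel p m a b y (p 1)) :
    y = p 0 ∨ y = p 2 := by
  have h1 : 1 ≤ m := by omega
  rcases h with h | h
  · rcases h with ⟨j, hj, e, rfl⟩ | ⟨j, hj, e, rfl⟩ | ⟨h | h | h | h, -⟩
    · exact absurd e.symm hy
    · rw [← hp 1 h1 j hj.le e]
      exact .inr rfl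
    · exact absurd (hp 1 h1 0 (by omega) h) (by omega)
    · exact absurd (hp 1 h1 m le_rfl h) (by omega)
    · exact absurd h (hpa 1 h1)
    · exact absurd h (hpb 1 h1)
  · rcases h with ⟨j, hj, rfl, e⟩ | ⟨j, hj, rfl, e⟩ | ⟨-, h | h⟩
    · exact absurd e.symm hy
    · have := hp 1 h1 (j + 1) hj e
      rw [show j = 0 by omega]
      exact .inl rfl
    · exact absurd h (hpa 1 h1)
    · exact absurd h (hpb 1 h1)

/-- Removing the second vertex of the path. -/
theorem pathRel_skip {V : Type*} {p : ℕ → V} {m : ℕ} {a b x y : V} (hm : 1 ≤ m) (hx : x ≠ p 1) (hy : y ≠ p 1)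
    (h : pathRel p (m + 1) a b x y) :
    pathRel (fun k => if k = 0 then p 0 else p (k + 1)) m a b x y := by
  rcases h with ⟨j, hj, rfl, rfl⟩ | ⟨j, hj, rfl, rfl⟩ | ⟨h, h'⟩
  · left
    rcases j with - | j
    · exact ⟨0, by omega, by simp⟩
    · have : j ≠ 0 := fun h => hx (by rw [h])
      exact ⟨j, by omega, by simp [this]⟩
  · right; left
    rcases j with - | j
    · exact absurd rfl hy
    · have : j ≠ 0 := fun h => hx (by rw [h])
      exact ⟨j, by omega, by simp [this]⟩
  · right; right
    refine ⟨?_, h'⟩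
    have : m ≠ 0 := by omega
    simpa [this] using h

/-- Induction on `m`, eliminating the inner vertex `p 1`; for `m = 1` the support lies in four
vertices. Bounding the support instead of prescribing it lets the hypothesis survive both
cancellations and Schur complements. -/
theorem IsCopositive.isSPN_of_pathRel (m : ℕ) (hm : 1 ≤ m) (p : ℕ → V) (a b : V)
    (hp : ∀ k ≤ m, ∀ l ≤ m, p k = p l → k = l) (hpa : ∀ k ≤ m, p k ≠ a) (hpb : ∀ k ≤ m, p k ≠ b)
    (hA : IsCopositive A)
    (hE : ∀ x y, A x y ≠ 0 → pathRel p m a b x y ∨ pathRel p m a b y x) : IsSPN A := by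
  classical
  induction m, hm using Nat.le_induction generalizing A p with
  | base =>
    have h4 : ∀ x y, pathRel p 1 a b x y →
        x ∈ ({p 0, p 1, a, b} : Finset V) ∧ y ∈ ({p 0, p 1, a, b} : Finset V) := by
      rintro x y (⟨j, hj, rfl, rfl⟩ | ⟨j, hj, rfl, rfl⟩ | ⟨h, h'⟩)
      · interval_cases j <;> simp
      · interval_cases j; simp
      · simp only [Finset.mem_insert, Finset.mem_singleton]
        tauto
    exact hA.isSPN_of_card_le_four {p 0, p 1, a, b} Finset.card_le_four fun x y hxy =>
      (hE x y hxy).elim (h4 x y) fun h => (h4 y x h).symm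
  | succ m hm ih =>
    refine IsCopositive.isSPN_of_row
      (fun x y => pathRel p (m + 1) a b x y ∨ pathRel p (m + 1) a b y x) (p 1) ?_ ?_ hA hE
    · intro A hA hE j hj1 hpos u hu huq hu1 huj hus
      rcases pathRel_second (by omega) hp hpa hpb hj1 (hE _ _ hpos.ne') with rfl | rfl
      · rw [hA.1.apply] at hpos
        rw [add_comm] at hus
        exact hA.isSPN_of_path_edge hp hpa hpb hE (k := 0) (by omega) hpos hu huq huj hu1 hus
      · exact hA.isSPN_of_path_edge hp hpa hpb hE (k := 1) (by omega) hpos hu huq hu1 huj hus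
    · intro A hA hE hneg
      have hS := hA.isCopositive_schurMatrix hneg
      refine hA.isSPN_of_schurMatrix (p 1) (ih (fun k => if k = 0 then p 0 else p (k + 1))
        ?_ ?_ ?_ hS fun x y hxy => ?_)
      · intro k hk l hl e
        have := hp (if k = 0 then 0 else k + 1) (by split_ifs <;> omega)
          (if l = 0 then 0 else l + 1) (by split_ifs <;> omega) (by
            split_ifs at e ⊢ <;> exact e)
        split_ifs at this <;> omega
      · intro k hk
        split_ifs
        · exact hpa 0 (by omega)
        · exact hpa (k + 1) (by omega)
      · intro k hk
        split_ifs
        · exact hpb 0 (by omega)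
        · exact hpb (k + 1) (by omega)
      · have hx : x ≠ p 1 := by
          rintro rfl
          exact hxy (hA.schurMatrix_apply_left hneg y)
        have hy : y ≠ p 1 := by
          rintro rfl
          rw [hS.1.apply] at hxy
          exact hxy (hA.schurMatrix_apply_left hneg x)
        -- Fill-in occurs only between neighbours of `p 1`, that is, on `p 0` and `p 2`, which are
        -- consecutive on the shortened path.
        by_cases h : A x y = 0
        · have h1 : A (p 1) x ≠ 0 := fun h0 => hxy (by simp [schurMatrix, h, h0])
          have h2 : A (p 1) y ≠ 0 := fun h0 => hxy (by simp [schurMatrix, h, h0])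
          have hm0 : 0 < m := hm
          rcases pathRel_second (by omega) hp hpa hpb hx (hE _ _ h1) with rfl | rfl <;>
            rcases pathRel_second (by omega) hp hpa hpb hy (hE _ _ h2) with rfl | rfl
          · exact .inl (.inl ⟨0, by omega, by simp⟩)
          · exact .inl (.inr (.inl ⟨0, hm0, by simp⟩))
          · exact .inr (.inr (.inl ⟨0, hm0, by simp⟩))
          · exact .inl (.inl ⟨1, hm, by simp⟩)
        · exact (hE x y h).imp (pathRel_skip hm hx hy) (pathRel_skip hm hy hx)

end Path

/-! ### The graphs `DR_n` -/

theorem mainTheorem8 (n : ℕ) (hn : 5 ≤ n) {V : Type*} [Fintype V] (G : SimpleGraph V)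
    (hG : Nonempty (G ≃g graphDR n)) : IsSPNGraph G := by
  obtain ⟨f⟩ := hG
  rintro A hA rfl
  -- The value for `k ≥ n` is arbitrary: the path uses `k ≤ n - 3`, and `a`, `b` are `p (n - 2)`, `p
  -- (n - 1)`.
  let p : ℕ → V := fun k => f.symm (if h : k < n then ⟨k, h⟩ else ⟨0, by omega⟩)
  have hpv : ∀ k (h : k < n), p k = f.symm ⟨k, h⟩ := fun k h => by simp [p, h]
  have hpf : ∀ x : V, x = p (f x).val := fun x => by rw [hpv _ (f x).isLt]; simp
  have hp : ∀ k < n, ∀ l < n, p k = p l → k = l := fun k hk l hl e => by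
    rw [hpv k hk, hpv l hl] at e
    simpa using f.symm.injective e
  refine hA.isSPN_of_pathRel (n - 3) (by omega) p (p (n - 2)) (p (n - 1))
    (fun k hk l hl => hp k (by omega) l (by omega))
    (fun k hk e => by have := hp k (by omega) _ (by omega) e; omega)
    (fun k hk e => by have := hp k (by omega) _ (by omega) e; omega) fun x y hxy => ?_
  have key : ∀ i j : Fin n, ((i.val + 1 = j.val ∧ j.val + 3 ≤ n) ∨
      ((i.val = 0 ∨ i.val + 3 = n) ∧ (j.val + 2 = n ∨ j.val + 1 = n)) ∨
      (i.val + 2 = n ∧ j.val + 1 = n)) →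
      pathRel p (n - 3) (p (n - 2)) (p (n - 1)) (p i.val) (p j.val) := by
    rintro i j (⟨h1, h2⟩ | ⟨h1, h2⟩ | ⟨h1, h2⟩)
    · exact .inr (.inl ⟨i.val, by omega, rfl, by rw [h1]⟩)
    · refine .inr (.inr ⟨?_, ?_⟩)
      · rcases h1 with h1 | h1
        · exact .inl (by rw [h1])
        · exact .inr (.inl (by rw [show i.val = n - 3 by omega]))
      · rcases h2 with h2 | h2
        · exact .inl (by rw [show j.val = n - 2 by omega])
        · exact .inr (by rw [show j.val = n - 1 by omega])
    · exact .inr (.inr ⟨.inr (.inr (.inl (by rw [show i.val = n - 2 by omega]))),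
        .inr (by rw [show j.val = n - 1 by omega])⟩)
  by_cases hne : x = y
  · subst hne
    left
    rw [hpf x]
    have hlt := (f x).isLt
    by_cases h : (f x).val ≤ n - 3
    · exact .inl ⟨_, h, rfl, rfl⟩
    · refine .inr (.inr ⟨.inr (.inr ?_), ?_⟩) <;>
      · rcases (by omega : (f x).val = n - 2 ∨ (f x).val = n - 1) with h | h
        · exact .inl (by rw [h])
        · exact .inr (by rw [h])
  · have hadj : (matrixGraph A).Adj x y :=
      (SimpleGraph.fromRel_adj _ _ _).2 ⟨hne, .inl hxy⟩
    have h := (SimpleGraph.fromRel_adj _ _ _).1 (f.map_rel_iff.2 hadj)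
    rw [hpf x, hpf y]
    exact h.2.imp (key _ _) (key _ _)
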